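/- Let $X$ be a finite set and let $X^*$ be the set of finite words over $X$, partially ordered by the prefix relation; write $X^n$ for the set of words of length $n$. Let $\mathrm{Aut}(X^*)$ be the group of bijections $g$ of $X^*$ such that $u$ is a prefix of $v$ if and only if $g(u)$ is a prefix of $g(v)$. For $g\in\mathrm{Aut}(X^*)$ and $x\in X^*$ let $\psi_x(g)=g_x\in\mathrm{Aut}(X^*)$ be the section of $g$ at $x$, determined by $g(xw)=g(x)g_x(w)$ for all $w\in X^*$. For $K\le\mathrm{Aut}(X^*)$ and $Y\subseteq X^*$, let $\mathrm{st}_K(Y)$ be the pointwise stabilizer of $Y$ in $K$, and put $\mathrm{st}_K(n):=\mathrm{st}_K(X^n)$. Let $G\le\mathrm{Aut}(X^*)$ be a group such that (a) $G$ is finitely generated; (b) $G$ is just infinite, i.e. $G$ is infinite and every proper quotient of $G$ (quotient by a non-trivial normal subgroup) is finite; (c) $G$ is strongly self-replicating, i.e. $\psi_x(\mathrm{st}_G(n))=G$ for all $n\ge 1$ and all $x\in X^n$; (d) $G$ has well-approximated subgroups, i.e. $\bigcap_{n\ge 0}H\,\mathrm{st}_G(n)=H$ for every finitely generated subgroup $H\le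 G$. Let $Y\subseteq X^*$ be a spanning leaf set: $Y$ is finite, no element of $Y$ is a prefix of a different element of $Y$, and there is an $N$ such that every word of length at least $N$ has a prefix in $Y$. Let $H\le G$ be such that $\mathrm{st}_H(Y)$, regarded as a subgroup of $\mathrm{Aut}(X^*)^Y$ via $h\mapsto(\psi_y(h))_{y\in Y}$, is an infra-direct product of $G^Y$: it is contained in $G^Y$, and $\psi_y(\mathrm{st}_H(Y))$ has finite index in $G$ for every $y\in Y$. Then $$\mathrm{rk_{CB}}(H)=\mathrm{depth}(H);\qquad\text{in particular}\quad \mathrm{rk_{CB}}(H)<\omega .$$ Here $\mathrm{depth}(H)\in\mathbb{N}\cup\{\infty\}$ is the supremum (taken to be $0$ if there is no such $n$) of the natural numbers $n$ for which there is a series of subgroups $G=H_0>H_1>\dots>H_n=H$ with $|H_i:H_{i+1}|=\infty$ for all $i<n$. The number $\mathrm{rk_{CB}}(H)$ is the Cantor--Bendixson rank of $H$ as a point of the Chabauty space $\mathrm{Sub}(G)$, the set of subgroups of $G$ with the topology induced from the product topology on $\{0,1\}^G$ by identifying subgroups with their indicator functions: it is the ordinal $\alpha$ such that $H\in\mathrm{Sub}(G)^{\alpha}\setminus\mathrm{Sub}(G)^{\alpha+1}$,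 and $\infty$ if there is no such $\alpha$, where $\mathrm{Sub}(G)^{0}=\mathrm{Sub}(G)$, $\mathrm{Sub}(G)^{\alpha+1}$ is the set of limit points of $\mathrm{Sub}(G)^{\alpha}$, and $\mathrm{Sub}(G)^{\lambda}=\bigcap_{\alpha<\lambda}\mathrm{Sub}(G)^{\alpha}$ for limit ordinals $\lambda$. -/

import Mathlib

open scoped Pointwise CantorBendixson

universe u

/-- `Aut(X^*)`: bijections of the set of finite words over `X` that preserve and reflect the
prefix relation. -/
abbrev TreeAut (X : Type u) : Type u :=
  RelIso (fun v w : List X => v <+: w) (fun v w : List X => v <+: w)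

namespace TreeAut

variable {X : Type u}

theorem prefix_iff (g : TreeAut X) (v w : List X) : g v <+: g w ↔ v <+: w :=
  g.map_rel_iff

theorem length_le_length_apply (g : TreeAut X) (w : List X) : w.length ≤ (g w).length := by
  induction w using List.reverseRecOn with
  | nil => simp
  | append_singleton v a ih =>
    have h1 : g v <+: g (v ++ [a]) := (g.prefix_iff _ _).2 (List.prefix_append _ _)
    have h2 : (g v).length ≠ (g (v ++ [a])).length := fun h => by
      have h3 := g.injective (h1.eq_of_length h)
      simp at h3
    have h4 := h1.length_le
    simp only [List.length_append, List.length_cons, List.length_nil]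
    omega

@[simp] theorem length_apply (g : TreeAut X) (w : List X) : (g w).length = w.length := by
  refine le_antisymm ?_ (g.length_le_length_apply w)
  have h := (g⁻¹).length_le_length_apply (g w)
  rwa [RelIso.inv_apply_self] at h

theorem apply_append_eq (g : TreeAut X) (u w : List X) :
    g (u ++ w) = g u ++ (g (u ++ w)).drop u.length := by
  obtain ⟨t, ht⟩ := (g.prefix_iff u (u ++ w)).2 (List.prefix_append u w)
  rw [← ht, ← g.length_apply u, List.drop_left]

/-- The section `g_u` of `g` at `u`: the automorphism determined by `g (u w) = g(u) g_u(w)`. -/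
def sectionAt (g : TreeAut X) (u : List X) : TreeAut X where
  toFun w := (g (u ++ w)).drop u.length
  invFun w := (g⁻¹ (g u ++ w)).drop u.length
  left_inv w := by
    dsimp only
    rw [← g.apply_append_eq u w, RelIso.inv_apply_self, List.drop_left]
  right_inv w := by
    dsimp only
    have h := (g⁻¹).apply_append_eq (g u) w
    rw [RelIso.inv_apply_self, g.length_apply] at h
    rw [← h, RelIso.apply_inv_self, ← g.length_apply u, List.drop_left]
  map_rel_iff' {v w} := by
    have h := g.prefix_iff (u ++ v) (u ++ w)
    rw [g.apply_append_eq u v, g.apply_append_eq u w, List.prefix_append_right_inj,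
      List.prefix_append_right_inj] at h
    exact h

theorem apply_append (g : TreeAut X) (u w : List X) : g (u ++ w) = g u ++ g.sectionAt u w :=
  g.apply_append_eq u w

theorem sectionAt_one (u : List X) : (1 : TreeAut X).sectionAt u = 1 := by
  ext1 w
  have h := (1 : TreeAut X).apply_append u w
  simpa using h.symm

theorem sectionAt_mul (g h : TreeAut X) (u : List X) :
    (g * h).sectionAt u = g.sectionAt (h u) * h.sectionAt u := by
  ext1 w
  have e := (g * h).apply_append u w
  rw [RelIso.mul_apply, RelIso.mul_apply, h.apply_append, g.apply_append] at e
  exact (List.append_cancel_left e).symm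

/-- The pointwise stabilizer in `Aut(X^*)` of a set `Y` of words. -/
def st (Y : Set (List X)) : Subgroup (TreeAut X) where
  carrier := {g | ∀ y ∈ Y, g y = y}
  mul_mem' {g h} hg hh y hy := by rw [RelIso.mul_apply, hh y hy, hg y hy]
  one_mem' _ _ := rfl
  inv_mem' {g} hg y hy := by
    have h := RelIso.inv_apply_self g y
    rwa [hg y hy] at h

/-- The pointwise stabilizer in `Aut(X^*)` of the `n`-th level `X^n`. -/
def levelSt (X : Type u) (n : ℕ) : Subgroup (TreeAut X) :=
  st {w : List X | w.length = n}

/-- The homomorphism `ψ_Y = ∏_{y ∈ Y} ψ_y` on the stabilizer of `Y`, where `ψ_y g` is the section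
of `g` at `y`. -/
def psi (Y : Finset (List X)) : st (Y : Set (List X)) →* (Y → TreeAut X) where
  toFun g y := (g : TreeAut X).sectionAt y
  map_one' := funext fun y => sectionAt_one (y : List X)
  map_mul' g h := funext fun y => by
    have e : (h : TreeAut X) (y : List X) = y := h.2 y y.2
    simp only [Subgroup.coe_mul, sectionAt_mul, e, Pi.mul_apply]

/-- For `H ≤ Aut(X^*)`, the stabilizer `st_H(Y)` regarded, through `ψ_Y`, as a subgroup of
`Aut(X^*)^Y`. -/
def stImage (H : Subgroup (TreeAut X)) (Y : Finset (List X)) : Subgroup (Y → TreeAut X) :=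
  (H.subgroupOf (st (Y : Set (List X)))).map (psi Y)

/-- A finite set of words is a leaf set if no member is a prefix of another one; it is spanning if
every sufficiently long word has a prefix in it. -/
def IsSpanningLeafSet (Y : Finset (List X)) : Prop :=
  (∀ x ∈ Y, ∀ y ∈ Y, x ≠ y → ¬ x <+: y) ∧
    ∃ N : ℕ, ∀ x : List X, N ≤ x.length → ∃ y ∈ Y, y <+: x

/-- `ψ_x(st_G(n)) = G` for all `n ≥ 1` and all words `x` of length `n`. -/
def StronglySelfReplicating (G : Subgroup (TreeAut X)) : Prop :=
  ∀ n : ℕ, 1 ≤ n → ∀ x : List X, x.length = n →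
    (fun g : TreeAut X => g.sectionAt x) '' ((G ⊓ levelSt X n : Subgroup (TreeAut X)) :
      Set (TreeAut X)) = (G : Set (TreeAut X))

/-- `⋂ₙ H st_G(n) = H` for every finitely generated subgroup `H` of `G`. -/
def WellApproximatedSubgroups (G : Subgroup (TreeAut X)) : Prop :=
  ∀ H : Subgroup G, H.FG →
    ⋂ n : ℕ, (H : Set G) * ((levelSt X n).subgroupOf G : Set G) = (H : Set G)

end TreeAut

/-- For a subgroup `G` of `A`, the subgroup `K` of `A^ι` is an infra-direct product of `G^ι`: it is
contained in `G^ι` and each of its coordinate projections has finite index in `G`. -/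
def IsInfraDirectProduct {A : Type*} [Group A] {ι : Type*} (G : Subgroup A)
    (K : Subgroup (ι → A)) : Prop :=
  K ≤ Subgroup.pi Set.univ (fun _ => G) ∧
    ∀ i : ι, ((K.map (Pi.evalMonoidHom (fun _ : ι => A) i)).subgroupOf G).FiniteIndex

/-- An infinite group all of whose proper quotients are finite. -/
def JustInfinite (G : Type*) [Group G] : Prop :=
  Infinite G ∧ ∀ N : Subgroup G, N.Normal → N ≠ ⊥ → Finite (G ⧸ N)

/-- The depth of `L` in `G`: the supremum of the lengths `n` of the series
`G = c 0 > c 1 > ⋯ > c n = L` with all indices `|c i : c (i + 1)|` infinite. The supremum of the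
empty set is `0`, and `Subgroup.relIndex` is `0` exactly for infinite relative index. -/
noncomputable def Subgroup.depth {G : Type*} [Group G] (L : Subgroup G) : ℕ∞ :=
  sSup {m : ℕ∞ | ∃ n : ℕ, m = n ∧ ∃ c : ℕ → Subgroup G, c 0 = ⊤ ∧ c n = L ∧
    ∀ i < n, c (i + 1) < c i ∧ (c (i + 1)).relIndex (c i) = 0}

open Classical in
/-- The Chabauty topology on the set of subgroups of the discrete group `G`, induced from the product
topology on `{0,1}^G` by identifying a subgroup with its indicator function. -/
noncomputable instance chabautyTopology (G : Type*) [Group G] : TopologicalSpace (Subgroup G) :=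
  TopologicalSpace.induced (fun (H : Subgroup G) (g : G) => decide (g ∈ H))
    Pi.topologicalSpace

/-- `x` lies in the `α`-th Cantor–Bendixson derivative of the space but not in the next one. -/
def HasCBRank {T : Type u} [TopologicalSpace T] (x : T) (α : Ordinal.{u}) : Prop :=
  x ∈ (Set.univ : Set T)ᵈ[α] ∧ x ∉ (Set.univ : Set T)ᵈ[α + 1]

theorem HasCBRank.unique {T : Type u} [TopologicalSpace T] {x : T} {α β : Ordinal.{u}}
    (hα : HasCBRank x α) (hβ : HasCBRank x β) : α = β := by
  have key : ∀ {γ δ : Ordinal.{u}}, HasCBRank x γ → HasCBRank x δ → ¬ γ < δ := by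
    intro γ δ hγ hδ h
    exact hγ.2 (CantorBendixson.iteratedDerivedSet_antitone _
      (Order.add_one_le_of_lt h) hδ.1)
  exact le_antisymm (not_lt.1 (key hβ hα)) (not_lt.1 (key hα hβ))

open Classical in
/-- The Cantor–Bendixson rank of a point `x`: the ordinal `α` such that `x` lies in the `α`-th
derivative but not in the `(α + 1)`-st one, and `⊤` if there is no such ordinal. -/
noncomputable def cbRank {T : Type u} [TopologicalSpace T] (x : T) : WithTop Ordinal.{u} :=
  if h : ∃ α : Ordinal.{u}, HasCBRank x α then ((Classical.choose h : Ordinal.{u}) :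
    WithTop Ordinal.{u}) else ⊤

theorem cbRank_eq_coe_iff {T : Type u} [TopologicalSpace T] (x : T) (α : Ordinal.{u}) :
    cbRank x = (α : WithTop Ordinal.{u}) ↔ HasCBRank x α := by
  unfold cbRank
  constructor
  · intro e
    split_ifs at e with h
    · rw [← WithTop.coe_inj.1 e]
      exact Classical.choose_spec h
    · exact absurd e.symm (WithTop.coe_ne_top)
  · intro hα
    have h : ∃ α : Ordinal.{u}, HasCBRank x α := ⟨α, hα⟩
    rw [dif_pos h, (Classical.choose_spec h).unique hα]

/-!
Put `D` for the family of subgroups `L` of `G` such that, for a fixed large level `n`, every section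
map `ψ_x`, `|x| = n`, takes `st_L(n)` onto a finite index subgroup of `G`. It is upward closed and
contains `H` (`TreeAut.finiteIndex_map_sectionHom`). Three properties of the members `L` of `D` give
the theorem: `L` is finitely generated, has finite depth, and has only finitely many overgroups in
which it has finite index. Indeed, `L` then has a neighbourhood consisting of `L` and of overgroups
in which it has infinite index; these have smaller depth, so the rank is at most the depth
(`notMem_iteratedDerivedSet_of_depth_eq`). Conversely, let `M > L` be the last step of a series.
As `L` is finitely generated, well-approximation makes it the limit of its overgroups
`M ∩ L st_G(k)`, which have finite index in `M` and hence at least the depth of `M`; so the rank is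
at least the depth (`mem_iteratedDerivedSet_of_le_depth`).

The three properties are proved for subgroups `K` of a group with finitely many jointly injective
homomorphisms `f i` to `G` such that all `f i K` have finite index. Every subgroup `L ≥ K` is
filtered by the kernels of the `f i`, and the images in `G` of the successive terms (`layer`) are
normalized by `f i K`. In this way everything reduces to subgroups `A` of `G` which are normal in a
finite index normal subgroup `N` of `G`.

Here the structure of `G` enters. It is just infinite and not virtually abelian: an abelian subgroup
`M` of finite index has finite quotients of exponent prime to `q` by the level stabilizers, for a
prime `q` larger than the size of the alphabet, so well-approximation would give `M = M ^ q`
(`TreeAut.not_commutative_of_wellApproximatedSubgroups`). Hence the centralizer of a finite index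
subgroup is trivial, and so is every abelian normal subgroup of `N`. It follows that `A` and its
centralizer in `N` generate their direct product, which has finite index
(`JustInfiniteNotVirtAbelian.sup_centralizer_finiteIndex`). Therefore `A` is a quotient of a
finitely generated group; an infinite index step `A < B` of normal subgroups of `N` produces the non-trivial
normal subgroup `B ∩ C_N(A)`, and there are at most `|G : N|` pairwise commuting ones of these
(`JustInfiniteNotVirtAbelian.card_le_index`), which bounds the depth; and `K` has finite index in
its commensurator (`JustInfiniteNotVirtAbelian.relIndex_ne_zero_of_commensurates`), which contains
all overgroups in which `K` has finite index.
-/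

/-! ### Just infinite groups that are not virtually abelian -/

/-- A group all of whose proper quotients are finite and none of whose finite index subgroups is
commutative. Such a group is infinite. -/
structure JustInfiniteNotVirtAbelian (G : Type*) [Group G] : Prop where
  finiteIndex_of_ne_bot : ∀ N : Subgroup G, N.Normal → N ≠ ⊥ → N.FiniteIndex
  not_commutative : ∀ M : Subgroup G, M.FiniteIndex → ¬ ∀ a ∈ M, ∀ b ∈ M, a * b = b * a

/-- `A` is a normal subgroup of the subgroup `N`. -/
structure Subgroup.IsNormalIn {G : Type*} [Group G] (A N : Subgroup G) : Prop where
  le : A ≤ N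
  conj_mem : ∀ n ∈ N, ∀ a ∈ A, n * a * n⁻¹ ∈ A

namespace Subgroup

variable {G : Type*} [Group G]

theorem mem_conj_smul_iff {g x : G} {A : Subgroup G} :
    x ∈ MulAut.conj g • A ↔ g⁻¹ * x * g ∈ A := by
  rw [mem_pointwise_smul_iff_inv_smul_mem, ← map_inv]
  simp [MulAut.smul_def]

namespace IsNormalIn

variable {N A B : Subgroup G}

theorem refl (N : Subgroup G) : N.IsNormalIn N :=
  ⟨le_rfl, fun _ hn _ ha => N.mul_mem (N.mul_mem hn ha) (N.inv_mem hn)⟩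

theorem inf (hA : A.IsNormalIn N) (hB : B.IsNormalIn N) : (A ⊓ B).IsNormalIn N :=
  ⟨inf_le_left.trans hA.le, fun n hn a ha => ⟨hA.conj_mem n hn a ha.1, hB.conj_mem n hn a ha.2⟩⟩

theorem centralizer_inf (hA : A.IsNormalIn N) : (centralizer (A : Set G) ⊓ N).IsNormalIn N := by
  refine ⟨inf_le_right, fun n hn c hc => ⟨mem_centralizer_iff.2 fun a ha => ?_,
    N.mul_mem (N.mul_mem hn hc.2) (N.inv_mem hn)⟩⟩
  have h := hA.conj_mem _ (N.inv_mem hn) a ha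
  have e := mem_centralizer_iff.1 hc.1 _ h
  calc a * (n * c * n⁻¹) = n * (n⁻¹ * a * n⁻¹⁻¹ * c) * n⁻¹ := by group
    _ = n * (c * (n⁻¹ * a * n⁻¹⁻¹)) * n⁻¹ := by rw [e]
    _ = n * c * n⁻¹ * a := by group

theorem conj [hN : N.Normal] (hA : A.IsNormalIn N) (g : G) : (MulAut.conj g • A).IsNormalIn N := by
  refine ⟨fun x hx => ?_, fun n hn a ha => ?_⟩
  · have h := hN.conj_mem _ (hA.le (mem_conj_smul_iff.1 hx)) g
    convert h using 1
    group
  · rw [mem_conj_smul_iff] at ha ⊢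
    convert hA.conj_mem (g⁻¹ * n * g) (by simpa using hN.conj_mem n hn g⁻¹) _ ha using 1
    group

/-- Conjugates of a normal subgroup of `N` depend only on the coset modulo `N`. -/
theorem conj_mul (hA : A.IsNormalIn N) (g : G) {n : G} (hn : n ∈ N) :
    MulAut.conj (g * n) • A = MulAut.conj g • A := by
  ext x
  rw [mem_conj_smul_iff, mem_conj_smul_iff]
  constructor
  · intro h
    convert hA.conj_mem n hn _ h using 1
    group
  · intro h
    convert hA.conj_mem n⁻¹ (N.inv_mem hn) _ h using 1
    group

theorem le_centralizer_of_inf_eq_bot (hA : A.IsNormalIn N) (hB : B.IsNormalIn N)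
    (h : A ⊓ B = ⊥) : A ≤ centralizer (B : Set G) := by
  intro a ha
  refine mem_centralizer_iff.2 fun b hb => ?_
  have h1 : b * a * b⁻¹ * a⁻¹ ∈ A ⊓ B := by
    refine ⟨A.mul_mem (hA.conj_mem b (hB.le hb) a ha) (A.inv_mem ha), ?_⟩
    have := B.mul_mem hb (hB.conj_mem a (hA.le ha) b⁻¹ (B.inv_mem hb))
    rwa [← mul_assoc, ← mul_assoc] at this
  rw [h, mem_bot] at h1
  exact mul_inv_eq_iff_eq_mul.1 (mul_inv_eq_one.1 h1)

/-- Replacing `B` successively by smaller subgroups, once for each coset of `N`, makes a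
hereditary property hold simultaneously with respect to all elements of the group. -/
theorem exists_forall_of_hereditary [N.FiniteIndex]
    (P : G → Subgroup G → Prop)
    (mono : ∀ g A B, A ≤ B → P g B → P g A)
    (coset : ∀ g A, A.IsNormalIn N → ∀ n ∈ N, P g A → P (g * n) A)
    (step : ∀ g B, B ≤ A → B.IsNormalIn N → B ≠ ⊥ →
      ∃ C ≤ B, C.IsNormalIn N ∧ C ≠ ⊥ ∧ P g C)
    (hA : A.IsNormalIn N) (hA' : A ≠ ⊥) :
    ∃ B ≤ A, B.IsNormalIn N ∧ B ≠ ⊥ ∧ ∀ g, P g B := by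
  classical
  have key : ∀ F : Finset G, ∃ B ≤ A, B.IsNormalIn N ∧ B ≠ ⊥ ∧ ∀ g ∈ F, P g B := by
    intro F
    induction F using Finset.induction_on with
    | empty => exact ⟨A, le_rfl, hA, hA', by simp⟩
    | insert g F _ ih =>
      obtain ⟨B, hBA, hB, hB', hP⟩ := ih
      obtain ⟨C, hCB, hC, hC', hg⟩ := step g B hBA hB hB'
      refine ⟨C, hCB.trans hBA, hC, hC', fun x hx => ?_⟩
      rcases Finset.mem_insert.1 hx with rfl | hx
      · exact hg
      · exact mono x C B hCB (hP x hx)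
  obtain ⟨F, hF⟩ : ∃ F : Finset G, ∀ q : G ⧸ N, ∃ g ∈ F, (g : G ⧸ N) = q := by
    have : Fintype (G ⧸ N) := Fintype.ofFinite _
    exact ⟨Finset.univ.image Quotient.out, fun q =>
      ⟨q.out, Finset.mem_image_of_mem _ (Finset.mem_univ _), Quotient.out_eq' q⟩⟩
  obtain ⟨B, hBA, hB, hB', hP⟩ := key F
  refine ⟨B, hBA, hB, hB', fun x => ?_⟩
  obtain ⟨g, hg, e⟩ := hF x
  have := coset g B hB _ (QuotientGroup.eq.1 e) (hP g hg)
  rwa [mul_inv_cancel_left] at this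

end IsNormalIn

end Subgroup

namespace JustInfiniteNotVirtAbelian

open Subgroup

variable {G : Type*} [Group G] {N A B : Subgroup G}

theorem ne_bot_of_finiteIndex (hG : JustInfiniteNotVirtAbelian G) (M : Subgroup G)
    [hM : M.FiniteIndex] : M ≠ ⊥ := by
  rintro rfl
  refine hG.not_commutative ⊥ hM fun a ha b hb => ?_
  rw [mem_bot.1 ha, mem_bot.1 hb]

theorem centralizer_eq_bot (hG : JustInfiniteNotVirtAbelian G) (M : Subgroup G)
    [M.FiniteIndex] : centralizer (M : Set G) = ⊥ := by
  have hle : centralizer (M : Set G) ≤ centralizer (M.normalCore : Set G) :=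
    centralizer_le M.normalCore_le
  rw [eq_bot_iff]
  refine hle.trans (le_of_eq ?_)
  by_contra hne
  have h := hG.finiteIndex_of_ne_bot (centralizer (M.normalCore : Set G)) inferInstance hne
  refine hG.not_commutative (centralizer (M.normalCore : Set G) ⊓ M.normalCore) inferInstance ?_
  intro a ha b hb
  exact mem_centralizer_iff.1 hb.1 a ha.2

theorem eq_bot_of_le_centralizer (hG : JustInfiniteNotVirtAbelian G) {M : Subgroup G}
    [M.FiniteIndex] (h : M ≤ centralizer (A : Set G)) : A = ⊥ := by
  rw [eq_bot_iff, ← hG.centralizer_eq_bot M]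
  exact le_centralizer_iff.1 h

theorem normalClosure_finiteIndex (hG : JustInfiniteNotVirtAbelian G) (hA : A ≠ ⊥) :
    (normalClosure (A : Set G)).FiniteIndex :=
  hG.finiteIndex_of_ne_bot _ inferInstance
    (ne_bot_of_le_ne_bot hA fun _ h => subset_normalClosure h)

/-- If `B` centralizes every conjugate of a non-trivial subgroup, then it centralizes a
non-trivial normal subgroup, which has finite index, so it is trivial. -/
theorem eq_bot_of_conj_le_centralizer (hG : JustInfiniteNotVirtAbelian G) (hA : A ≠ ⊥)
    (h : ∀ g : G, MulAut.conj g • A ≤ centralizer (B : Set G)) : B = ⊥ := by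
  have := hG.normalClosure_finiteIndex hA
  refine hG.eq_bot_of_le_centralizer (M := normalClosure (A : Set G)) ?_
  rw [normalClosure, closure_le]
  intro x hx
  obtain ⟨a, ha, hax⟩ := Group.mem_conjugatesOfSet_iff.1 hx
  obtain ⟨g, rfl⟩ := isConj_iff.1 hax
  refine h g (mem_conj_smul_iff.2 ?_)
  rwa [mul_assoc, mul_assoc, inv_mul_cancel, mul_one, inv_mul_cancel_left]

/-- An abelian normal subgroup of `N` shrinks to one that commutes with all its conjugates, and then
centralizes the finite index subgroup generated by them. -/
theorem eq_bot_of_commutative [N.Normal] [N.FiniteIndex] (hG : JustInfiniteNotVirtAbelian G)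
    (hA : A.IsNormalIn N) (hcomm : A ≤ centralizer (A : Set G)) : A = ⊥ := by
  by_contra hne
  have step : ∀ (g : G) (B : Subgroup G), B ≤ A → B.IsNormalIn N → B ≠ ⊥ →
      ∃ C ≤ B, C.IsNormalIn N ∧ C ≠ ⊥ ∧
      MulAut.conj g • C ≤ centralizer (C : Set G) := by
    intro g B hBA hB hB'
    by_cases h : B ⊓ MulAut.conj g • B = ⊥
    · exact ⟨B, le_rfl, hB, hB', le_centralizer_iff.1
        (hB.le_centralizer_of_inf_eq_bot (hB.conj g) h)⟩
    · refine ⟨B ⊓ MulAut.conj g • B, inf_le_left, hB.inf (hB.conj g), h, ?_⟩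
      refine (pointwise_smul_le_pointwise_smul_iff.2 inf_le_left).trans
        (le_trans (fun x hx => mem_centralizer_iff.2 fun y hy => ?_) (centralizer_le inf_le_right))
      have e := mem_centralizer_iff.1 (hcomm (hBA (mem_conj_smul_iff.1 hx))) _
        (hBA (mem_conj_smul_iff.1 hy))
      calc y * x = g * (g⁻¹ * y * g * (g⁻¹ * x * g)) * g⁻¹ := by group
        _ = g * (g⁻¹ * x * g * (g⁻¹ * y * g)) * g⁻¹ := by rw [e]
        _ = x * y := by group
  obtain ⟨B, hBA, hB, hB', hP⟩ := hA.exists_forall_of_hereditary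
    (fun g B => MulAut.conj g • B ≤ centralizer (B : Set G))
    (fun g C D hCD h => (pointwise_smul_le_pointwise_smul_iff.2 hCD).trans
      (h.trans (centralizer_le hCD)))
    (fun g B hB n hn h => by rwa [hB.conj_mul g hn]) step hne
  exact hB' (hG.eq_bot_of_conj_le_centralizer hB' hP)

theorem inf_eq_bot_of_le_centralizer [N.Normal] [N.FiniteIndex]
    (hG : JustInfiniteNotVirtAbelian G) (hA : A.IsNormalIn N) (hB : B.IsNormalIn N)
    (h : A ≤ centralizer (B : Set G)) : A ⊓ B = ⊥ :=
  hG.eq_bot_of_commutative (hA.inf hB)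
    (inf_le_left.trans (h.trans (centralizer_le inf_le_right)))

theorem inf_centralizer_eq_bot [N.Normal] [N.FiniteIndex]
    (hG : JustInfiniteNotVirtAbelian G) (hA : A.IsNormalIn N) :
    A ⊓ (centralizer (A : Set G) ⊓ N) = ⊥ :=
  hG.inf_eq_bot_of_le_centralizer hA hA.centralizer_inf
    (le_centralizer_iff.1 inf_le_left)

/-- A normal subgroup of `N` together with its centralizer in `N` generates a subgroup of finite
index: it meets all non-trivial normal subgroups of `N`, hence so does the intersection of its
finitely many conjugates, which is therefore not trivial. -/
theorem sup_centralizer_finiteIndex [hN : N.Normal] [N.FiniteIndex]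
    (hG : JustInfiniteNotVirtAbelian G) (hA : A.IsNormalIn N) :
    (A ⊔ (centralizer (A : Set G) ⊓ N)).FiniteIndex := by
  set C := centralizer (A : Set G) ⊓ N with hC
  have hCN : C.IsNormalIn N := hA.centralizer_inf
  have hE : (A ⊔ C).IsNormalIn N := by
    refine ⟨sup_le hA.le hCN.le, fun n hn x hx => ?_⟩
    have : A ⊔ C ≤ MulAut.conj n⁻¹ • (A ⊔ C) := by
      rw [smul_sup]
      refine sup_le_sup (fun a ha => ?_) (fun a ha => ?_)
      · rw [mem_conj_smul_iff, inv_inv]; exact hA.conj_mem n hn a ha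
      · rw [mem_conj_smul_iff, inv_inv]; exact hCN.conj_mem n hn a ha
    have h := mem_conj_smul_iff.1 (this hx)
    rwa [inv_inv] at h
  have meets : ∀ B : Subgroup G, B.IsNormalIn N → B ≠ ⊥ → B ⊓ (A ⊔ C) ≠ ⊥ := by
    intro B hB hB' h
    have h1 : B ⊓ A = ⊥ := eq_bot_iff.2 (h ▸ inf_le_inf_left B le_sup_left)
    have h2 : B ≤ C := le_inf (hB.le_centralizer_of_inf_eq_bot hA h1) hB.le
    exact hB' (by rwa [inf_eq_left.2 (h2.trans le_sup_right)] at h)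
  have step : ∀ (g : G) (B : Subgroup G), B ≤ N → B.IsNormalIn N → B ≠ ⊥ →
      ∃ D ≤ B, D.IsNormalIn N ∧ D ≠ ⊥ ∧
      D ≤ MulAut.conj g • (A ⊔ C) := by
    intro g B _ hB hB'
    refine ⟨B ⊓ MulAut.conj g • (A ⊔ C), inf_le_left, hB.inf (hE.conj g), fun h => ?_,
      inf_le_right⟩
    refine meets _ (hB.conj g⁻¹) (fun h' => hB' ?_) ?_
    · rw [map_inv, inv_smul_eq_iff, smul_bot] at h'
      exact h'
    · have := congrArg (fun S => MulAut.conj g⁻¹ • S) h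
      simpa [smul_inf, smul_bot] using this
  obtain ⟨B, -, hB, hB', hP⟩ := (IsNormalIn.refl N).exists_forall_of_hereditary
    (fun g B => B ≤ MulAut.conj g • (A ⊔ C)) (fun g A B h h' => h.trans h')
    (fun g B hB n hn h => by rwa [hE.conj_mul g hn]) step
    (hG.ne_bot_of_finiteIndex N)
  have hcore : (A ⊔ C).normalCore ≠ ⊥ := by
    refine ne_bot_of_le_ne_bot hB' fun b hb g => ?_
    have := mem_conj_smul_iff.1 (hP g⁻¹ hb)
    rwa [inv_inv] at this
  have := hG.finiteIndex_of_ne_bot _ inferInstance hcore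
  exact finiteIndex_of_le (normalCore_le (A ⊔ C))

/-- A normal subgroup of `N` has finite index in a larger one as soon as the latter contains no
non-trivial element centralizing the former. -/
theorem relIndex_ne_zero_of_inf_centralizer_eq_bot [N.Normal] [N.FiniteIndex]
    (hG : JustInfiniteNotVirtAbelian G) (hA : A.IsNormalIn N) (hAB : A ≤ B)
    (h : B ⊓ (centralizer (A : Set G) ⊓ N) = ⊥) : A.relIndex B ≠ 0 := by
  have := hG.sup_centralizer_finiteIndex hA
  set C := centralizer (A : Set G) ⊓ N with hC
  have e : (A ⊔ C) ⊓ B ≤ A := by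
    rintro x ⟨hx, hxB⟩
    have hx' : x ∈ ((A ⊔ C : Subgroup G) : Set G) := hx
    rw [coe_mul_of_left_le_normalizer_right A C
      ((le_centralizer_iff.1 (inf_le_left (b := N))).trans (centralizer_le_normalizer _))] at hx'
    obtain ⟨a, ha, c, hc, rfl⟩ := Set.mem_mul.1 hx'
    have hcB : c ∈ B := by
      have := B.mul_mem (B.inv_mem (hAB ha)) hxB
      rwa [inv_mul_cancel_left] at this
    have : c ∈ B ⊓ C := ⟨hcB, hc⟩
    rw [h, mem_bot] at this
    rwa [this, mul_one]
  have h1 : ((A ⊔ C) ⊓ B).relIndex B ≠ 0 := by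
    rw [inf_relIndex_right]
    exact fun h0 => this.index_ne_zero (index_eq_zero_of_relIndex_eq_zero h0)
  exact fun h0 => h1 (relIndex_eq_zero_of_le_left e h0)

/-- A normal subgroup of `N` is a direct factor of a finite index subgroup. -/
theorem fg_of_isNormalIn [N.Normal] [N.FiniteIndex]
    (hG : JustInfiniteNotVirtAbelian G) (hfg : Group.FG G) (hA : A.IsNormalIn N) : A.FG := by
  have := hG.sup_centralizer_finiteIndex hA
  set C := centralizer (A : Set G) ⊓ N with hC
  have hcomm : ∀ (a : A) (c : C), Commute (A.subtype a) (C.subtype c) := fun a c =>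
    mem_centralizer_iff.1 c.2.1 a a.2
  let f : A × C →* G := MonoidHom.noncommCoprod A.subtype C.subtype hcomm
  have hf : Function.Injective f := by
    rw [MonoidHom.noncommCoprod_injective]
    refine ⟨A.subtype_injective, C.subtype_injective, ?_⟩
    rw [range_subtype, range_subtype, disjoint_iff]
    exact hG.inf_centralizer_eq_bot hA
  have hr : f.range.FiniteIndex := by
    rw [MonoidHom.noncommCoprod_range, range_subtype, range_subtype]
    exact this
  have h1 : Group.FG f.range := f.range.fg_of_index_ne_zero
  have h2 : Group.FG (A × C) :=
    Group.fg_of_surjective (f := (MonoidHom.ofInjective hf).symm.toMonoidHom)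
      (MonoidHom.ofInjective hf).symm.surjective
  rw [← Group.fg_iff_subgroup_fg]
  exact Group.fg_of_surjective (f := MonoidHom.fst A C) Prod.fst_surjective

/-- The number of pairwise commuting non-trivial normal subgroups of `N` is at most the index
of `N`: some non-trivial normal subgroup `B` of `N` has the property that each of its conjugates
meets at most one member of the family, while each member must meet some conjugate of `B`. -/
theorem card_le_index [hN : N.Normal] [N.FiniteIndex]
    (hG : JustInfiniteNotVirtAbelian G) {ι : Type*} (s : Finset ι) (D : ι → Subgroup G)
    (hD : ∀ i ∈ s, (D i).IsNormalIn N) (hne : ∀ i ∈ s, D i ≠ ⊥)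
    (hcomm : ∀ i ∈ s, ∀ j ∈ s, i ≠ j → D i ≤ centralizer (D j : Set G)) :
    s.card ≤ N.index := by
  have disj : ∀ i ∈ s, ∀ j ∈ s, i ≠ j → D i ⊓ D j = ⊥ := fun i hi j hj hij =>
    hG.inf_eq_bot_of_le_centralizer (hD i hi) (hD j hj) (hcomm i hi j hj hij)
  have step : ∀ (g : G) (B : Subgroup G), B ≤ N → B.IsNormalIn N → B ≠ ⊥ →
      ∃ C ≤ B, C.IsNormalIn N ∧ C ≠ ⊥ ∧
      ∀ i ∈ s, ∀ j ∈ s, MulAut.conj g • C ⊓ D i ≠ ⊥ → MulAut.conj g • C ⊓ D j ≠ ⊥ → i = j := by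
    intro g B _ hB hB'
    by_cases h : ∃ i ∈ s, MulAut.conj g • B ⊓ D i ≠ ⊥
    · -- shrink `B` so that its conjugate by `g` lies in one member of the family
      obtain ⟨i, hi, h⟩ := h
      have e : MulAut.conj g • (B ⊓ MulAut.conj g⁻¹ • D i) = MulAut.conj g • B ⊓ D i := by
        rw [smul_inf, map_inv, smul_inv_smul]
      have key : ∀ j ∈ s, MulAut.conj g • (B ⊓ MulAut.conj g⁻¹ • D i) ⊓ D j ≠ ⊥ → i = j := by
        intro j hj h1
        by_contra hij
        rw [e] at h1
        refine h1 (eq_bot_iff.2 ?_)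
        rw [← disj i hi j hj hij]
        exact inf_le_inf_right _ inf_le_right
      refine ⟨B ⊓ MulAut.conj g⁻¹ • D i, inf_le_left, hB.inf ((hD i hi).conj g⁻¹), fun h' => h ?_,
        fun j hj k hk h1 h2 => (key j hj h1).symm.trans (key k hk h2)⟩
      rw [← e, h', smul_bot]
    · push Not at h
      exact ⟨B, le_rfl, hB, hB', fun i hi _ _ h1 => absurd (h i hi) h1⟩
  obtain ⟨B, -, hB, hB', hP⟩ := (IsNormalIn.refl N).exists_forall_of_hereditary
    (fun g B => ∀ i ∈ s, ∀ j ∈ s, MulAut.conj g • B ⊓ D i ≠ ⊥ →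
      MulAut.conj g • B ⊓ D j ≠ ⊥ → i = j)
    (fun g A B h h' i hi j hj h1 h2 => h' i hi j hj
      (ne_bot_of_le_ne_bot h1 (inf_le_inf_right _ (pointwise_smul_le_pointwise_smul_iff.2 h)))
      (ne_bot_of_le_ne_bot h2 (inf_le_inf_right _ (pointwise_smul_le_pointwise_smul_iff.2 h))))
    (fun g B hB n hn h => by simpa only [hB.conj_mul g hn] using h) step
    (hG.ne_bot_of_finiteIndex N)
  have hex : ∀ i ∈ s, ∃ g : G, MulAut.conj g • B ⊓ D i ≠ ⊥ := by
    intro i hi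
    by_contra! h
    exact hne i hi (hG.eq_bot_of_conj_le_centralizer hB' fun g =>
      (hB.conj g).le_centralizer_of_inf_eq_bot (hD i hi) (h g))
  choose! g hg using hex
  have : Fintype (G ⧸ N) := Fintype.ofFinite _
  rw [index_eq_card, Nat.card_eq_fintype_card, ← Finset.card_univ]
  refine Finset.card_le_card_of_injOn (fun i => (g i : G ⧸ N)) (fun _ _ => Finset.mem_univ _) ?_
  intro i hi j hj hij
  have e := hB.conj_mul (g i) (QuotientGroup.eq.1 hij)
  rw [mul_inv_cancel_left] at e
  exact hP (g i) i hi j hj (hg i hi) (e ▸ hg j hj)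

end JustInfiniteNotVirtAbelian

/-! ### Subgroups filtered by a finite family of homomorphisms -/

namespace Subgroup

variable {Γ G : Type*} [Group Γ] [Group G]

theorem relIndex_ne_zero_of_map_of_ker (f : Γ →* G) {L M : Subgroup Γ} (hLM : L ≤ M)
    (hmap : (L.map f).relIndex (M.map f) ≠ 0)
    (hker : (L ⊓ f.ker).relIndex (M ⊓ f.ker) ≠ 0) : L.relIndex M ≠ 0 := by
  have h1 : ((L ⊔ f.ker) ⊓ M).relIndex M ≠ 0 := by
    rwa [inf_relIndex_right, ← comap_map_eq, relIndex_comap]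
  refine relIndex_ne_zero_trans ?_ h1
  have h2 : L.relIndex (M ⊓ f.ker) ≠ 0 := fun h =>
    hker (relIndex_eq_zero_of_le_left inf_le_left h)
  -- every left coset of `L` in `L ⊔ ker f` has a representative in `ker f`
  have hle : M ⊓ f.ker ≤ (L ⊔ f.ker) ⊓ M :=
    le_inf (inf_le_right.trans le_sup_right) inf_le_left
  have hfin : Finite ((M ⊓ f.ker : Subgroup Γ) ⧸ L.subgroupOf (M ⊓ f.ker)) :=
    have : (L.subgroupOf (M ⊓ f.ker)).FiniteIndex := ⟨h2⟩
    inferInstance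
  have hsurj : Function.Surjective (quotientSubgroupOfEmbeddingOfLE L hle) := by
    intro q
    induction q using QuotientGroup.induction_on with
    | H x =>
      obtain ⟨x, hx, hxM⟩ := x
      have hx' : x ∈ ((f.ker ⊔ L : Subgroup Γ) : Set Γ) := by rwa [sup_comm]
      rw [normal_mul] at hx'
      obtain ⟨k, hk, l, hl, rfl⟩ := Set.mem_mul.1 hx'
      refine ⟨QuotientGroup.mk ⟨k, ?_, hk⟩, ?_⟩
      · have := M.mul_mem hxM (M.inv_mem (hLM hl))
        rwa [mul_inv_cancel_right] at this
      · rw [quotientSubgroupOfEmbeddingOfLE_apply_mk, QuotientGroup.eq, mem_subgroupOf]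
        simpa using hl
  have := Finite.of_surjective _ hsurj
  exact index_ne_zero_of_finite

theorem relIndex_map_ne_zero (f : Γ →* G) {L M : Subgroup Γ} (h : L.relIndex M ≠ 0) :
    (L.map f).relIndex (M.map f) ≠ 0 := by
  rw [← relIndex_comap]
  exact fun h0 => h (relIndex_eq_zero_of_le_left (le_comap_map f L) h0)

theorem finiteIndex_map_of_relIndex_ne_zero (f : Γ →* G) {L M : Subgroup Γ}
    (h : L.relIndex M ≠ 0) (hM : (M.map f).FiniteIndex) : (L.map f).FiniteIndex := by
  refine ⟨?_⟩
  rw [← relIndex_top_right]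
  exact relIndex_ne_zero_trans (relIndex_map_ne_zero f h)
    (by rw [relIndex_top_right]; exact hM.index_ne_zero)

theorem fg_map (f : Γ →* G) {L : Subgroup Γ} (h : L.FG) : (L.map f).FG := by
  rw [← Group.fg_iff_subgroup_fg] at h ⊢
  exact Group.fg_of_surjective (f.subgroupMap_surjective L)

theorem fg_of_map_of_ker (f : Γ →* G) {L : Subgroup Γ} (hmap : (L.map f).FG)
    (hker : (L ⊓ f.ker).FG) : L.FG := by
  classical
  obtain ⟨T, hT⟩ := hmap
  have hlift : ∀ t ∈ T, ∃ l ∈ L, f l = t := fun t ht =>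
    mem_map.1 (hT ▸ subset_closure ht)
  choose! g hgL hg using hlift
  have hS : closure ((T.image g : Finset Γ) : Set Γ) ≤ L := by
    rw [closure_le, Finset.coe_image]
    rintro _ ⟨t, ht, rfl⟩
    exact hgL t ht
  have e : closure ((T.image g : Finset Γ) : Set Γ) ⊔ (L ⊓ f.ker) = L := by
    refine le_antisymm (sup_le hS inf_le_left) fun l hl => ?_
    have h1 : L.map f ≤ (closure ((T.image g : Finset Γ) : Set Γ)).map f := by
      rw [← hT, closure_le]
      exact fun t ht => ⟨g t, subset_closure (by simpa using ⟨t, ht, rfl⟩), hg t ht⟩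
    obtain ⟨s, hs, hsl⟩ := h1 (mem_map_of_mem f hl)
    have h2 : s⁻¹ * l ∈ L ⊓ f.ker :=
      ⟨L.mul_mem (L.inv_mem (hS hs)) hl, MonoidHom.mem_ker.2 (by simp [hsl])⟩
    simpa using mul_mem_sup hs h2
  rw [← e]
  exact FG.sup ⟨_, rfl⟩ hker

theorem fg_of_relIndex_ne_zero {H K : Subgroup G} (hHK : H ≤ K) (hH : H.FG)
    (h : H.relIndex K ≠ 0) : K.FG := by
  have hfin : Finite (K ⧸ H.subgroupOf K) :=
    have : (H.subgroupOf K).FiniteIndex := ⟨h⟩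
    inferInstance
  let r : Set G := Set.range fun q : K ⧸ H.subgroupOf K => (q.out : G)
  have e : closure r ⊔ H = K := by
    refine le_antisymm (sup_le ((closure_le _).2 ?_) hHK) fun k hk => ?_
    · rintro _ ⟨q, rfl⟩
      exact q.out.2
    · let q : K ⧸ H.subgroupOf K := QuotientGroup.mk ⟨k, hk⟩
      have h1 : q.out⁻¹ * ⟨k, hk⟩ ∈ H.subgroupOf K := QuotientGroup.eq.1 (Quotient.out_eq' q)
      have h2 : (q.out : G) ∈ closure r := subset_closure ⟨q, rfl⟩
      simpa using mul_mem_sup h2 (mem_subgroupOf.1 h1)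
  rw [← e]
  exact FG.sup ((fg_iff _).2 ⟨r, rfl, Set.finite_range _⟩) hH

end Subgroup

section Layers

open Subgroup

variable {Γ G : Type*} [Group Γ] [Group G] {m : ℕ} (f : Fin m → Γ →* G)

/-- The common kernel of the homomorphisms `f j` with `j < k`. -/
def kerBelow (k : ℕ) : Subgroup Γ := ⨅ (j : Fin m) (_ : (j : ℕ) < k), (f j).ker

variable {f}

theorem mem_kerBelow {k : ℕ} {x : Γ} :
    x ∈ kerBelow f k ↔ ∀ j : Fin m, (j : ℕ) < k → f j x = 1 := by
  simp [kerBelow, mem_iInf, MonoidHom.mem_ker]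

theorem kerBelow_zero : kerBelow f 0 = ⊤ :=
  eq_top_iff.2 fun _ _ => mem_kerBelow.2 fun _ h => absurd h (Nat.not_lt_zero _)

theorem kerBelow_succ (i : Fin m) : kerBelow f (i + 1) = kerBelow f i ⊓ (f i).ker := by
  ext x
  rw [mem_inf, mem_kerBelow, mem_kerBelow, MonoidHom.mem_ker]
  refine ⟨fun h => ⟨fun j hj => h j (by omega), h i (by omega)⟩, fun h j hj => ?_⟩
  rcases Nat.lt_succ_iff_lt_or_eq.1 hj with hj | hj
  · exact h.1 j hj
  · rw [Fin.ext hj]; exact h.2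

theorem kerBelow_eq_bot (hf : ∀ x, (∀ j, f j x = 1) → x = 1) : kerBelow f m = ⊥ :=
  eq_bot_iff.2 fun x hx => mem_bot.2 (hf x fun j => mem_kerBelow.1 hx j j.2)

instance kerBelow_normal (k : ℕ) : (kerBelow f k).Normal :=
  ⟨fun x hx g => mem_kerBelow.2 fun j hj => by simp [mem_kerBelow.1 hx j hj]⟩

variable (f) in
/-- The image under `f i` of the elements of `L` that are killed by all `f j` with `j < i`. -/
def layer (L : Subgroup Γ) (i : Fin m) : Subgroup G := (L ⊓ kerBelow f i).map (f i)

theorem layer_mono {L M : Subgroup Γ} (h : L ≤ M) (i : Fin m) : layer f L i ≤ layer f M i :=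
  map_mono (inf_le_inf_right _ h)

theorem isNormalIn_layer_inf {K L : Subgroup Γ} (h : K ≤ L) (i : Fin m) :
    (layer f L i ⊓ (K.map (f i)).normalCore).IsNormalIn (K.map (f i)).normalCore := by
  refine ⟨inf_le_right, fun n hn a ha => ⟨?_, Normal.conj_mem inferInstance a ha.2 n⟩⟩
  obtain ⟨k, hk, rfl⟩ := normalCore_le _ hn
  obtain ⟨l, hl, rfl⟩ := ha.1
  refine ⟨k * l * k⁻¹, ⟨L.mul_mem (L.mul_mem (h hk) hl.1) (L.inv_mem (h hk)),
    Normal.conj_mem inferInstance l hl.2 k⟩, by simp⟩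

/-- Descending induction along the kernels `kerBelow f k`, from the trivial group to the whole
group. -/
theorem layer_induction (hf : ∀ x, (∀ j, f j x = 1) → x = 1) (P : Subgroup Γ → Subgroup Γ → Prop)
    (bot : P ⊥ ⊥) {L M : Subgroup Γ}
    (step : ∀ i : Fin m, P ((L ⊓ kerBelow f i) ⊓ (f i).ker) ((M ⊓ kerBelow f i) ⊓ (f i).ker) →
      P (L ⊓ kerBelow f i) (M ⊓ kerBelow f i)) : P L M := by
  have key : ∀ k ≤ m, P (L ⊓ kerBelow f (m - k)) (M ⊓ kerBelow f (m - k)) := by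
    intro k
    induction k with
    | zero =>
      intro _
      rw [Nat.sub_zero, kerBelow_eq_bot hf, inf_bot_eq, inf_bot_eq]
      exact bot
    | succ k ih =>
      intro hk
      have h := step ⟨m - (k + 1), by omega⟩
      rw [inf_assoc, inf_assoc, ← kerBelow_succ] at h
      refine h ?_
      have e : m - (k + 1) + 1 = m - k := by omega
      simp only [e]
      exact ih (by omega)
  simpa [kerBelow_zero] using key m le_rfl

theorem relIndex_ne_zero_of_layer (hf : ∀ x, (∀ j, f j x = 1) → x = 1) {L M : Subgroup Γ}
    (hLM : L ≤ M) (h : ∀ i, (layer f L i).relIndex (layer f M i) ≠ 0) : L.relIndex M ≠ 0 :=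
  layer_induction hf (fun L M => L.relIndex M ≠ 0) (by simp)
    fun i hi => relIndex_ne_zero_of_map_of_ker (f i) (inf_le_inf_right _ hLM) (h i) hi

theorem fg_of_layer (hf : ∀ x, (∀ j, f j x = 1) → x = 1) {L : Subgroup Γ}
    (h : ∀ i, (layer f L i).FG) : L.FG :=
  layer_induction (M := L) hf (fun L _ => L.FG) FG.bot
    fun i hi => fg_of_map_of_ker (f i) (h i) hi

end Layers

namespace JustInfiniteNotVirtAbelian

open Subgroup

variable {Γ G : Type*} [Group Γ] [Group G] {m : ℕ} {f : Fin m → Γ →* G} {K : Subgroup Γ}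

theorem fg_of_finiteIndex_map (hG : JustInfiniteNotVirtAbelian G) (hfg : Group.FG G)
    (hf : ∀ x, (∀ j, f j x = 1) → x = 1) (hK : ∀ i, (K.map (f i)).FiniteIndex) : K.FG := by
  refine fg_of_layer hf fun i => ?_
  have := hK i
  set N := (K.map (f i)).normalCore
  have h1 : (layer f K i ⊓ N).FG := hG.fg_of_isNormalIn hfg (isNormalIn_layer_inf le_rfl i)
  refine fg_of_relIndex_ne_zero inf_le_left h1 ?_
  rw [inf_relIndex_left]
  exact fun h0 => N.index_ne_zero_of_finite (index_eq_zero_of_relIndex_eq_zero h0)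

/-- A subgroup with finite index images has finite index in every larger subgroup that
commensurates it. -/
theorem relIndex_ne_zero_of_commensurates (hG : JustInfiniteNotVirtAbelian G)
    (hf : ∀ x, (∀ j, f j x = 1) → x = 1) (hK : ∀ i, (K.map (f i)).FiniteIndex)
    {L : Subgroup Γ} (hKL : K ≤ L)
    (hL : ∀ x ∈ L, ∃ Q ≤ K, Q.relIndex K ≠ 0 ∧ ∀ q ∈ Q, x * q * x⁻¹ ∈ K) :
    K.relIndex L ≠ 0 := by
  refine relIndex_ne_zero_of_layer hf hKL fun i => ?_
  have := hK i
  set N := (K.map (f i)).normalCore with hN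
  have hle : layer f K i ⊓ N ≤ layer f L i ⊓ N := inf_le_inf_right N (layer_mono hKL i)
  have h1 : (layer f K i ⊓ N).relIndex (layer f L i ⊓ N) ≠ 0 := by
    refine hG.relIndex_ne_zero_of_inf_centralizer_eq_bot (N := N)
      (isNormalIn_layer_inf le_rfl i) hle (eq_bot_iff.2 ?_)
    -- the commutators of `x` with `Q` fall into the layer of `K` and centralize it
    rintro _ ⟨⟨⟨x, hx, rfl⟩, -⟩, hxC⟩
    obtain ⟨Q, hQK, hQ, hxQ⟩ := hL x hx.1
    have := finiteIndex_map_of_relIndex_ne_zero (f i) hQ (hK i)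
    rw [← hG.centralizer_eq_bot (Q.map (f i) ⊓ N)]
    refine mem_centralizer_iff.2 ?_
    rintro _ ⟨⟨q, hq, rfl⟩, hqN⟩
    have hc : f i (x * q * x⁻¹ * q⁻¹) = f i x * (f i q * (f i x)⁻¹ * (f i q)⁻¹) := by
      simp [mul_assoc]
    have h2 : f i (x * q * x⁻¹ * q⁻¹) ∈ (layer f K i ⊓ N) ⊓
        (centralizer ((layer f K i ⊓ N : Subgroup G) : Set G) ⊓ N) := by
      have hC := (isNormalIn_layer_inf (f := f) (le_refl K) i).centralizer_inf
      have h3 := mul_mem hxC (hC.conj_mem _ hqN _ (inv_mem hxC))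
      rw [← hc] at h3
      refine ⟨⟨⟨_, ⟨K.mul_mem (hxQ q hq) (K.inv_mem (hQK hq)), ?_⟩, rfl⟩, h3.2⟩, h3⟩
      have := mul_mem hx.2 ((kerBelow_normal (f := f) i).conj_mem _ (inv_mem hx.2) q)
      rwa [← mul_assoc, ← mul_assoc] at this
    rw [hG.inf_centralizer_eq_bot (isNormalIn_layer_inf le_rfl i), mem_bot, hc] at h2
    have h3 : f i x * f i q * (f i x)⁻¹ * (f i q)⁻¹ = 1 := by simpa only [mul_assoc] using h2
    exact (mul_inv_eq_iff_eq_mul.1 (mul_inv_eq_one.1 h3)).symm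
  have h2 : (layer f K i ⊓ N).relIndex (layer f L i) ≠ 0 := by
    refine relIndex_ne_zero_trans h1 ?_
    rw [inf_relIndex_left]
    exact fun h0 => N.index_ne_zero_of_finite (index_eq_zero_of_relIndex_eq_zero h0)
  exact fun h0 => h2 (relIndex_eq_zero_of_le_left inf_le_left h0)

/-- The steps of infinite index in a chain of layers yield pairwise commuting non-trivial normal
subgroups. -/
theorem card_infinite_steps_layer_le (hG : JustInfiniteNotVirtAbelian G) (i : Fin m)
    [hK : (K.map (f i)).FiniteIndex] {c : ℕ → Subgroup Γ} (hc : Antitone c) (hKc : ∀ j, K ≤ c j)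
    (s : Finset ℕ) (hs : ∀ j ∈ s, (layer f (c (j + 1)) i).relIndex (layer f (c j) i) = 0) :
    s.card ≤ (K.map (f i)).normalCore.index := by
  set N := (K.map (f i)).normalCore with hN
  have hA : ∀ j, (layer f (c j) i ⊓ N).IsNormalIn N := fun j => isNormalIn_layer_inf (hKc j) i
  have hanti : ∀ j k, j ≤ k → layer f (c k) i ⊓ N ≤ layer f (c j) i ⊓ N := fun j k h =>
    inf_le_inf_right N (layer_mono (hc h) i)
  -- the elements of the `j`-th layer that centralize the next one
  let D : ℕ → Subgroup G := fun j => (layer f (c j) i ⊓ N) ⊓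
    (centralizer ((layer f (c (j + 1)) i ⊓ N : Subgroup G) : Set G) ⊓ N)
  have hcomm : ∀ j k, j < k → D j ≤ centralizer (D k : Set G) := fun j k h =>
    inf_le_right.trans (inf_le_left.trans (centralizer_le
      (inf_le_left.trans (hanti _ _ h))))
  refine hG.card_le_index s D (fun j _ => (hA j).inf (hA (j + 1)).centralizer_inf)
    (fun j hj h0 => ?_) (fun j _ k _ hjk => ?_)
  · have h1 := hG.relIndex_ne_zero_of_inf_centralizer_eq_bot (hA (j + 1))
      (hanti j (j + 1) j.le_succ) h0
    have h2 : (layer f (c (j + 1)) i ⊓ N).relIndex (layer f (c j) i) ≠ 0 := by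
      refine relIndex_ne_zero_trans h1 ?_
      rw [inf_relIndex_left]
      exact fun h0 => N.index_ne_zero_of_finite (index_eq_zero_of_relIndex_eq_zero h0)
    exact h2 (relIndex_eq_zero_of_le_left inf_le_left (hs j hj))
  · rcases lt_or_gt_of_ne hjk with h | h
    · exact hcomm j k h
    · exact le_centralizer_iff.1 (hcomm k j h)

/-- The number of steps of infinite index in a chain above a subgroup with finite index images is
bounded in terms of that subgroup. -/
theorem card_infinite_steps_le (hG : JustInfiniteNotVirtAbelian G)
    (hf : ∀ x, (∀ j, f j x = 1) → x = 1) (hK : ∀ i, (K.map (f i)).FiniteIndex)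
    {c : ℕ → Subgroup Γ} (hc : Antitone c) (hKc : ∀ j, K ≤ c j)
    (s : Finset ℕ) (hs : ∀ j ∈ s, (c (j + 1)).relIndex (c j) = 0) :
    s.card ≤ ∑ i, (K.map (f i)).normalCore.index := by
  classical
  have hcover : s ⊆ Finset.univ.biUnion fun i => s.filter fun j =>
      (layer f (c (j + 1)) i).relIndex (layer f (c j) i) = 0 := by
    intro j hj
    by_contra h
    refine relIndex_ne_zero_of_layer hf (hc j.le_succ) (fun i h0 => h ?_) (hs j hj)
    simp only [Finset.mem_biUnion, Finset.mem_filter, Finset.mem_univ, true_and]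
    exact ⟨i, hj, h0⟩
  refine (Finset.card_le_card hcover).trans (Finset.card_biUnion_le.trans
    (Finset.sum_le_sum fun i _ => ?_))
  have := hK i
  exact hG.card_infinite_steps_layer_le i hc hKc _ fun j hj => (Finset.mem_filter.1 hj).2

end JustInfiniteNotVirtAbelian

/-! ### Series with infinite indices -/

namespace Subgroup

variable {G : Type*} [Group G] {L M : Subgroup G} {n : ℕ}

/-- There is a series of length `n` from the whole group down to `L` all of whose indices are
infinite. -/
def HasInfiniteIndexSeries (L : Subgroup G) (n : ℕ) : Prop :=
  ∃ c : ℕ → Subgroup G, c 0 = ⊤ ∧ c n = L ∧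
    ∀ i < n, c (i + 1) < c i ∧ (c (i + 1)).relIndex (c i) = 0

theorem HasInfiniteIndexSeries.le_depth (h : L.HasInfiniteIndexSeries n) : (n : ℕ∞) ≤ L.depth :=
  le_sSup ⟨n, rfl, h⟩

theorem exists_hasInfiniteIndexSeries (h : ((n + 1 : ℕ) : ℕ∞) ≤ L.depth) :
    ∃ k, n ≤ k ∧ L.HasInfiniteIndexSeries (k + 1) := by
  have h1 : (n : ℕ∞) < L.depth := lt_of_lt_of_le (by exact_mod_cast n.lt_succ_self) h
  obtain ⟨_, ⟨k, rfl, hk⟩, hnk⟩ := lt_sSup_iff.1 h1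
  have h2 : n < k := by exact_mod_cast hnk
  obtain ⟨k, rfl⟩ : ∃ j, k = j + 1 := ⟨k - 1, by omega⟩
  exact ⟨k, by omega, hk⟩

theorem ne_of_relIndex_eq_zero (h : L.relIndex M = 0) : L ≠ M := by
  rintro rfl
  simp at h

theorem hasInfiniteIndexSeries_succ_iff :
    L.HasInfiniteIndexSeries (n + 1) ↔
      ∃ M, M.HasInfiniteIndexSeries n ∧ L ≤ M ∧ L.relIndex M = 0 := by
  constructor
  · rintro ⟨c, h0, rfl, h⟩
    exact ⟨c n, ⟨c, h0, rfl, fun i hi => h i (hi.trans n.lt_succ_self)⟩,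
      (h n n.lt_succ_self).1.le, (h n n.lt_succ_self).2⟩
  · rintro ⟨M, ⟨c, h0, rfl, h⟩, hle, hrel⟩
    refine ⟨fun i => if i ≤ n then c i else L, by simpa using h0, by simp, fun i hi => ?_⟩
    rcases Nat.lt_succ_iff_lt_or_eq.1 hi with hi | rfl
    · simpa [Nat.succ_le_of_lt hi, hi.le] using h i hi
    · simpa using ⟨lt_of_le_of_ne hle (ne_of_relIndex_eq_zero hrel), hrel⟩

theorem HasInfiniteIndexSeries.of_le (h : M.HasInfiniteIndexSeries (n + 1)) (hLM : L ≤ M) :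
    L.HasInfiniteIndexSeries (n + 1) := by
  obtain ⟨K, hK, hMK, h0⟩ := hasInfiniteIndexSeries_succ_iff.1 h
  exact hasInfiniteIndexSeries_succ_iff.2
    ⟨K, hK, hLM.trans hMK, relIndex_eq_zero_of_le_left hLM h0⟩

theorem succ_le_depth (hLM : L ≤ M) (h : L.relIndex M = 0) (hn : (n : ℕ∞) ≤ M.depth) :
    ((n + 1 : ℕ) : ℕ∞) ≤ L.depth := by
  cases n with
  | zero =>
    have h1 : L.HasInfiniteIndexSeries 1 := hasInfiniteIndexSeries_succ_iff.2
      ⟨⊤, ⟨fun _ => ⊤, rfl, rfl, by simp⟩, le_top, relIndex_eq_zero_of_le_right le_top h⟩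
    exact h1.le_depth
  | succ n =>
    obtain ⟨k, hk, hM⟩ := exists_hasInfiniteIndexSeries hn
    have h1 := (hasInfiniteIndexSeries_succ_iff.2 ⟨M, hM, hLM, h⟩).le_depth
    exact le_trans (by exact_mod_cast (by omega : n + 1 + 1 ≤ k + 1 + 1)) h1

theorem finite_setOf_le_of_relIndex_ne_zero (h : L.relIndex M ≠ 0) :
    {K : Subgroup G | L ≤ K ∧ K ≤ M}.Finite := by
  have : (L.subgroupOf M).FiniteIndex := ⟨h⟩
  refine Set.Finite.of_finite_image (f := fun K => {q : M ⧸ L.subgroupOf M | (q.out : G) ∈ K})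
    (Set.toFinite _) ?_
  have key : ∀ K : Subgroup G, L ≤ K → ∀ x : M, (x : G) ∈ K ↔
      (((x : M ⧸ L.subgroupOf M)).out : G) ∈ K := by
    intro K hK x
    have h1 : ((x : M ⧸ L.subgroupOf M)).out⁻¹ * x ∈ L.subgroupOf M :=
      QuotientGroup.eq.1 (Quotient.out_eq' _)
    have h2 := hK (mem_subgroupOf.1 h1)
    constructor
    · intro hx
      simpa using K.mul_mem hx (K.inv_mem h2)
    · intro hx
      simpa using K.mul_mem hx h2
  intro K hK K' hK' e
  have e' : ∀ q : M ⧸ L.subgroupOf M, (q.out : G) ∈ K ↔ (q.out : G) ∈ K' := fun q =>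
    Set.ext_iff.1 e q
  refine le_antisymm (fun x hx => ?_) (fun x hx => ?_)
  · exact (key K' hK'.1 ⟨x, hK.2 hx⟩).2 ((e' _).1 ((key K hK.1 ⟨x, hK.2 hx⟩).1 hx))
  · exact (key K hK.1 ⟨x, hK'.2 hx⟩).2 ((e' _).2 ((key K' hK'.1 ⟨x, hK'.2 hx⟩).1 hx))

end Subgroup

/-! ### The Chabauty space -/

section Chabauty

open Subgroup Filter Topology

variable {G : Type u} [Group G]

theorem isClopen_setOf_mem (g : G) : IsClopen {L : Subgroup G | g ∈ L} := by
  classical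
  have hc : Continuous fun L : Subgroup G => decide (g ∈ L) :=
    (continuous_apply g).comp
      (continuous_induced_dom : Continuous fun (L : Subgroup G) (g : G) => decide (g ∈ L))
  have := (isClopen_discrete ({true} : Set Bool)).preimage hc
  convert this using 1
  ext L
  simp

theorem exists_finset_of_mem_nhds {L : Subgroup G} {U : Set (Subgroup G)} (hU : U ∈ 𝓝 L) :
    ∃ F : Finset G, ∀ M : Subgroup G, (∀ g ∈ F, g ∈ M ↔ g ∈ L) → M ∈ U := by
  classical
  rw [nhds_induced, mem_comap] at hU
  obtain ⟨V, hV, hVU⟩ := hU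
  obtain ⟨W, hWV, hW, hLW⟩ := mem_nhds_iff.1 hV
  obtain ⟨F, u, hu, hFW⟩ := isOpen_pi_iff.1 hW _ hLW
  refine ⟨F, fun M hM => hVU (hWV (hFW fun g hg => ?_))⟩
  have h1 := (hu g hg).2
  have h2 := hM g hg
  simpa only [h2] using h1

theorem eventually_le_of_fg {L : Subgroup G} (hL : L.FG) : ∀ᶠ M in 𝓝 L, L ≤ M := by
  obtain ⟨S, rfl⟩ := hL
  have : ∀ᶠ M in 𝓝 (closure (S : Set G)), ∀ g ∈ S, g ∈ M :=
    (Filter.eventually_all_finset S).2 fun g hg =>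
      (isClopen_setOf_mem g).isOpen.mem_nhds (subset_closure hg)
  exact this.mono fun M hM => (closure_le M).2 hM

theorem eventually_ne_of_not_le {L M : Subgroup G} (h : ¬ M ≤ L) : ∀ᶠ K in 𝓝 L, K ≠ M := by
  obtain ⟨g, hgM, hgL⟩ := SetLike.not_le_iff_exists.1 h
  have : ∀ᶠ K in 𝓝 L, g ∉ K := (isClopen_setOf_mem g).compl.isOpen.mem_nhds hgL
  exact this.mono fun K hK e => hK (e ▸ hgM)

theorem mem_iteratedDerivedSet_succ {T : Type u} [TopologicalSpace T] {x : T} {n : ℕ} :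
    x ∈ (Set.univ : Set T)ᵈ[((n + 1 : ℕ) : Ordinal.{u})] ↔
      x ∈ (Set.univ : Set T)ᵈ[(n : Ordinal.{u})] ∧
      ∀ U ∈ 𝓝 x, ∃ y ∈ U, y ∈ (Set.univ : Set T)ᵈ[(n : Ordinal.{u})] ∧ y ≠ x := by
  rw [Nat.cast_succ, CantorBendixson.iteratedDerivedSet_succ,
    relDerivedSet_apply, Set.mem_inter_iff, mem_derivedSet, accPt_iff_nhds, and_comm]
  simp only [Set.mem_inter_iff, and_assoc]

/-- Every member of depth at least `d` of an upward closed family of subgroups that are closed in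
the topology given by `S` belongs to the `d`-th derivative: if `M` is the last but one term of a
series ending in `L`, then
`L` is the limit of the subgroups `M ∩ L S k`, which have finite index in `M`. -/
theorem mem_iteratedDerivedSet_of_le_depth {D : Set (Subgroup G)}
    (hup : ∀ L ∈ D, ∀ M, L ≤ M → M ∈ D)
    {S : ℕ → Subgroup G} [∀ k, (S k).Normal] [∀ k, (S k).FiniteIndex] (hS : Antitone S)
    (hclosed : ∀ L ∈ D, ⋂ k, (L : Set G) * (S k : Set G) = (L : Set G)) (d : ℕ) :
    ∀ L ∈ D, (d : ℕ∞) ≤ L.depth → L ∈ (Set.univ : Set (Subgroup G))ᵈ[(d : Ordinal.{u})] := by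
  induction d with
  | zero =>
    intro L _ _
    rw [Nat.cast_zero, CantorBendixson.iteratedDerivedSet_zero]
    trivial
  | succ d ih =>
    intro L hL hd
    refine mem_iteratedDerivedSet_succ.2 ⟨ih L hL (le_trans (by exact_mod_cast d.le_succ) hd),
      fun U hU => ?_⟩
    obtain ⟨n, hn, hser⟩ := exists_hasInfiniteIndexSeries hd
    obtain ⟨M, hM, hLM, h0⟩ := hasInfiniteIndexSeries_succ_iff.1 hser
    obtain ⟨F, hF⟩ := exists_finset_of_mem_nhds hU
    have hk : ∃ k, ∀ g ∈ F, g ∉ L → g ∉ L ⊔ S k := by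
      have h1 : ∀ g, ∃ k, g ∉ L → g ∉ L ⊔ S k := by
        intro g
        by_cases hg : g ∈ L
        · exact ⟨0, fun h => absurd hg h⟩
        · have h2 : g ∉ ⋂ k, (L : Set G) * (S k : Set G) := by rwa [hclosed L hL]
          simp only [Set.mem_iInter, not_forall] at h2
          obtain ⟨k, hk⟩ := h2
          exact ⟨k, fun _ h => hk (by rw [← mul_normal]; exact h)⟩
      choose k hk using h1
      refine ⟨F.sup k, fun g hg hgL h => hk g hgL ?_⟩
      exact sup_le_sup_left (hS (Finset.le_sup hg)) L h
    obtain ⟨k, hk⟩ := hk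
    have hLK : L ≤ M ⊓ (L ⊔ S k) := le_inf hLM le_sup_left
    refine ⟨M ⊓ (L ⊔ S k), hF _ fun g hg => ⟨fun h => ?_, fun h => hLK h⟩,
      ih _ (hup L hL _ hLK) ?_, fun e => ?_⟩
    · by_contra hgL
      exact hk g hg hgL h.2
    · cases d with
      | zero => exact bot_le
      | succ d =>
        obtain ⟨n, rfl⟩ : ∃ j, n = j + 1 := ⟨n - 1, by omega⟩
        exact le_trans (by exact_mod_cast hn) (hM.of_le inf_le_left).le_depth
    · have h1 : (L ⊔ S k).index ≠ 0 :=
        (finiteIndex_of_le (le_sup_right : S k ≤ L ⊔ S k)).index_ne_zero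
      refine h1 (index_eq_zero_of_relIndex_eq_zero (K := M) ?_)
      rw [← inf_relIndex_left, e]
      exact h0

/-- If the members of an upward closed family of finitely generated subgroups have finite depth and
finitely many overgroups of finite relative index, then no member of depth `d` belongs to the
`(d + 1)`-st derivative: the members of a suitable neighbourhood have smaller depth. -/
theorem notMem_iteratedDerivedSet_of_depth_eq {D : Set (Subgroup G)}
    (hup : ∀ L ∈ D, ∀ M, L ≤ M → M ∈ D) (hfg : ∀ L ∈ D, L.FG) (hdepth : ∀ L ∈ D, L.depth ≠ ⊤)
    (hfin : ∀ L ∈ D, {M : Subgroup G | L ≤ M ∧ L.relIndex M ≠ 0}.Finite) (d : ℕ) :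
    ∀ L ∈ D, L.depth = d →
      L ∉ (Set.univ : Set (Subgroup G))ᵈ[((d + 1 : ℕ) : Ordinal.{u})] := by
  induction d using Nat.strong_induction_on with
  | _ d ih =>
    intro L hL hd hmem
    have hne : ∀ᶠ K in 𝓝 L, ∀ M ∈ {M : Subgroup G | L ≤ M ∧ L.relIndex M ≠ 0}, M ≠ L → K ≠ M :=
      (Filter.eventually_all_finite (hfin L hL)).2 fun M hM => by
        by_cases h : M = L
        · exact Eventually.of_forall fun _ h' => absurd h h'
        · exact (eventually_ne_of_not_le fun h' => h (le_antisymm h' hM.1)).mono fun _ h _ => h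
    obtain ⟨K, ⟨hLK, hK⟩, hKd, hKL⟩ := (mem_iteratedDerivedSet_succ.1 hmem).2 _
      ((eventually_le_of_fg (hfg L hL)).and hne)
    have h0 : L.relIndex K = 0 := by
      by_contra h
      exact hK K ⟨hLK, h⟩ hKL rfl
    obtain ⟨e, he⟩ := ENat.ne_top_iff_exists.1 (hdepth K (hup L hL K hLK))
    have h1 := succ_le_depth hLK h0 he.le
    rw [hd] at h1
    have h2 : e + 1 ≤ d := by exact_mod_cast h1
    refine ih e h2 K (hup L hL K hLK) he.symm ?_
    exact CantorBendixson.iteratedDerivedSet_antitone _ (Nat.cast_le.2 h2) hKd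

theorem cbRank_eq_depth {D : Set (Subgroup G)}
    (hup : ∀ L ∈ D, ∀ M, L ≤ M → M ∈ D) (hfg : ∀ L ∈ D, L.FG) (hdepth : ∀ L ∈ D, L.depth ≠ ⊤)
    (hfin : ∀ L ∈ D, {M : Subgroup G | L ≤ M ∧ L.relIndex M ≠ 0}.Finite)
    {S : ℕ → Subgroup G} [∀ k, (S k).Normal] [∀ k, (S k).FiniteIndex] (hS : Antitone S)
    (hclosed : ∀ L ∈ D, ⋂ k, (L : Set G) * (S k : Set G) = (L : Set G))
    {L : Subgroup G} (hL : L ∈ D) :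
    cbRank L = ENat.map (fun n : ℕ => (n : Ordinal.{u})) L.depth ∧
      cbRank L < ((Ordinal.omega0 : Ordinal.{u}) : WithTop Ordinal.{u}) := by
  obtain ⟨d, hd⟩ := ENat.ne_top_iff_exists.1 (hdepth L hL)
  have h : cbRank L = ((d : Ordinal.{u}) : WithTop Ordinal.{u}) :=
    (cbRank_eq_coe_iff L _).2
      ⟨mem_iteratedDerivedSet_of_le_depth hup hS hclosed d L hL hd.le, by
        have := notMem_iteratedDerivedSet_of_depth_eq hup hfg hdepth hfin d L hL hd.symm
        rwa [Nat.cast_succ] at this⟩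
  rw [h, ← hd]
  exact ⟨rfl, WithTop.coe_lt_coe.2 (Ordinal.natCast_lt_omega0 d)⟩

end Chabauty

/-! ### Subgroups with finite index images -/

section FiniteIndexImages

open Subgroup

variable {Q G : Type*} [Group Q] [Group G] {Γ : Subgroup G} {m : ℕ}

/-- The intersection of `L` with `Γ` has a finite index image under each of the homomorphisms
`f i`. -/
def HasFiniteIndexImages (f : Fin m → Γ →* Q) (L : Subgroup G) : Prop :=
  ∀ i, ((L.subgroupOf Γ).map (f i)).FiniteIndex

variable {f : Fin m → Γ →* Q} {L M : Subgroup G}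

theorem HasFiniteIndexImages.mono (hL : HasFiniteIndexImages f L) (h : L ≤ M) :
    HasFiniteIndexImages f M := fun i =>
  have : ((L.subgroupOf Γ).map (f i)).FiniteIndex := hL i
  finiteIndex_of_le (map_mono (comap_mono h) :
    (L.subgroupOf Γ).map (f i) ≤ (M.subgroupOf Γ).map (f i))

theorem relIndex_subgroupOf_subgroupOf [hΓ : Γ.FiniteIndex] :
    (L.subgroupOf Γ).relIndex (M.subgroupOf Γ) = 0 ↔ L.relIndex M = 0 := by
  rw [subgroupOf, relIndex_comap, subgroupOf_map_subtype]
  refine ⟨fun h => relIndex_eq_zero_of_le_right inf_le_left h, fun h => ?_⟩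
  by_contra h0
  refine relIndex_ne_zero_trans h0 ?_ h
  rw [inf_relIndex_left]
  exact fun h => hΓ.index_ne_zero (index_eq_zero_of_relIndex_eq_zero h)

theorem HasFiniteIndexImages.fg [hΓ : Γ.FiniteIndex] (hL : HasFiniteIndexImages f L)
    (hQ : JustInfiniteNotVirtAbelian Q) (hfg : Group.FG Q) (hf : ∀ x, (∀ i, f i x = 1) → x = 1) :
    L.FG := by
  have h1 := fg_map Γ.subtype (hQ.fg_of_finiteIndex_map hfg hf hL)
  rw [subgroupOf_map_subtype] at h1
  refine fg_of_relIndex_ne_zero inf_le_left h1 ?_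
  rw [inf_relIndex_left]
  exact fun h => hΓ.index_ne_zero (index_eq_zero_of_relIndex_eq_zero h)

theorem HasFiniteIndexImages.depth_ne_top [Γ.FiniteIndex] (hL : HasFiniteIndexImages f L)
    (hQ : JustInfiniteNotVirtAbelian Q) (hf : ∀ x, (∀ i, f i x = 1) → x = 1) : L.depth ≠ ⊤ := by
  have h : L.depth ≤ ((∑ i, ((L.subgroupOf Γ).map (f i)).normalCore.index : ℕ) : ℕ∞) := by
    refine sSup_le ?_
    rintro _ ⟨n, rfl, c, -, rfl, hc⟩
    have hanti : Antitone fun j => (c (min j n)).subgroupOf Γ := by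
      refine antitone_nat_of_succ_le fun j => comap_mono ?_
      rcases lt_or_ge j n with hj | hj
      · rw [min_eq_left hj.le, min_eq_left (Nat.succ_le_of_lt hj)]
        exact (hc j hj).1.le
      · rw [min_eq_right hj, min_eq_right (hj.trans j.le_succ)]
    have hle : ∀ j, (c n).subgroupOf Γ ≤ (c (min j n)).subgroupOf Γ := fun j => by
      have := hanti (le_max_left j n)
      simpa using this
    have := hQ.card_infinite_steps_le hf hL hanti hle (Finset.range n) fun j hj => by
      have hj := Finset.mem_range.1 hj
      rw [relIndex_subgroupOf_subgroupOf, min_eq_left hj.le, min_eq_left (Nat.succ_le_of_lt hj)]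
      exact (hc j hj).2
    rw [Finset.card_range] at this
    exact_mod_cast this
  exact ne_top_of_le_ne_top (ENat.natCast_ne_top _) h

/-- Overgroups of finite relative index lie in the commensurator, in which a subgroup with finite
index images has finite index. -/
theorem HasFiniteIndexImages.finite_overgroups [Γ.FiniteIndex]
    (hL : HasFiniteIndexImages f L)
    (hQ : JustInfiniteNotVirtAbelian Q) (hf : ∀ x, (∀ i, f i x = 1) → x = 1) :
    {M : Subgroup G | L ≤ M ∧ L.relIndex M ≠ 0}.Finite := by
  have hover : ∀ M : Subgroup G, L ≤ M → L.relIndex M ≠ 0 →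
      M ≤ Commensurable.commensurator L := by
    intro M hLM h0 x hx
    have h1 : Commensurable L M := ⟨h0, by rw [relIndex_eq_one.2 hLM]; exact one_ne_zero⟩
    rw [h1.eq, Commensurable.commensurator_mem_iff,
      conjAct_pointwise_smul_eq_self (le_normalizer hx)]
  have hLC : L ≤ Commensurable.commensurator L := hover L le_rfl (by simp)
  have hrel : L.relIndex (Commensurable.commensurator L) ≠ 0 := by
    rw [ne_eq, ← relIndex_subgroupOf_subgroupOf (Γ := Γ)]
    refine hQ.relIndex_ne_zero_of_commensurates hf hL (comap_mono hLC) fun x hx => ?_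
    have hx' := (Commensurable.commensurator_mem_iff L _).1 (inv_mem (mem_subgroupOf.1 hx))
    refine ⟨(ConjAct.toConjAct (x : G)⁻¹ • L ⊓ L).subgroupOf Γ, comap_mono inf_le_right, ?_,
      fun q hq => ?_⟩
    · rw [ne_eq, relIndex_subgroupOf_subgroupOf, inf_relIndex_right]
      exact hx'.1
    · have h1 := (mem_pointwise_smul_iff_inv_smul_mem.1 (mem_subgroupOf.1 hq).1)
      rw [← map_inv, inv_inv, ConjAct.toConjAct_smul] at h1
      exact mem_subgroupOf.2 h1
  refine (finite_setOf_le_of_relIndex_ne_zero hrel).subset ?_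
  rintro M ⟨hLM, h0⟩
  exact ⟨hLM, hover M hLM h0⟩

end FiniteIndexImages

/-! ### Level stabilizers and sections -/

namespace TreeAut

open Subgroup

variable {X : Type u}

theorem mem_levelSt {n : ℕ} {g : TreeAut X} :
    g ∈ levelSt X n ↔ ∀ w : List X, w.length = n → g w = w := Iff.rfl

theorem apply_eq_of_apply_append_eq {g : TreeAut X} {u w : List X} (h : g (u ++ w) = u ++ w) :
    g u = u ∧ g.sectionAt u w = w := by
  rw [g.apply_append] at h
  exact List.append_inj h (g.length_apply u)

theorem levelSt_antitone [Nonempty X] : Antitone (levelSt X) := by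
  intro n k hnk g hg w hw
  have hw : w.length = n := hw
  let a : X := Classical.arbitrary X
  exact (apply_eq_of_apply_append_eq
    (hg (w ++ List.replicate (k - n) a) (by simp [hw, hnk]))).1

theorem sectionAt_append (g : TreeAut X) (u w : List X) :
    g.sectionAt (u ++ w) = (g.sectionAt u).sectionAt w := by
  ext1 v
  have h1 := g.apply_append (u ++ w) v
  rw [List.append_assoc, g.apply_append, (g.sectionAt u).apply_append, g.apply_append,
    List.append_assoc] at h1
  exact (List.append_cancel_left (List.append_cancel_left h1)).symm

/-- The action of an automorphism on the words of a fixed length. -/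
def levelPerm (X : Type u) (n : ℕ) : TreeAut X →* Equiv.Perm {w : List X // w.length = n} where
  toFun g :=
    { toFun := fun w => ⟨g w, by rw [g.length_apply, w.2]⟩
      invFun := fun w => ⟨g⁻¹ w, by rw [(g⁻¹).length_apply, w.2]⟩
      left_inv := fun w => Subtype.ext (RelIso.inv_apply_self g w)
      right_inv := fun w => Subtype.ext (RelIso.apply_inv_self g w) }
  map_one' := rfl
  map_mul' _ _ := rfl

theorem levelPerm_ker (n : ℕ) : (levelPerm X n).ker = levelSt X n := by
  ext g
  rw [MonoidHom.mem_ker, mem_levelSt]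
  refine ⟨fun h w hw => congrArg Subtype.val (Equiv.congr_fun h ⟨w, hw⟩), fun h => ?_⟩
  exact Equiv.ext fun w => Subtype.ext (h w w.2)

instance levelSt_normal (n : ℕ) : (levelSt X n).Normal := by
  rw [← levelPerm_ker]
  infer_instance

instance finite_level [Finite X] (n : ℕ) : Finite {w : List X // w.length = n} :=
  inferInstanceAs (Finite (List.Vector X n))

instance levelSt_finiteIndex [Finite X] (n : ℕ) : (levelSt X n).FiniteIndex := by
  rw [← levelPerm_ker]
  infer_instance

theorem pow_factorial_mem_levelSt [Finite X] {n : ℕ} {g : TreeAut X} (hg : g ∈ levelSt X n) :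
    g ^ (Nat.card X).factorial ∈ levelSt X (n + 1) := by
  have hpow : ∀ (u : List X), u.length = n → ∀ j : ℕ,
      (g ^ j).sectionAt u = g.sectionAt u ^ j := by
    intro u hu j
    induction j with
    | zero => rw [pow_zero, pow_zero, sectionAt_one]
    | succ j ih => rw [pow_succ, pow_succ, sectionAt_mul, hg u hu, ih]
  have hperm : ∀ h : TreeAut X, h ^ (Nat.card X).factorial ∈ levelSt X 1 := by
    intro h
    rw [← levelPerm_ker, MonoidHom.mem_ker, map_pow]
    have e : Nat.card (Equiv.Perm {w : List X // w.length = 1}) = (Nat.card X).factorial := by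
      rw [Nat.card_perm]
      congr 1
      have : Nat.card (List.Vector X 1) = Nat.card X := by
        have := Fintype.ofFinite X
        simp
      exact this
    rw [← e, pow_card_eq_one']
  intro w hw
  have hw : w.length = n + 1 := hw
  have hu : (w.take n).length = n := by simp [hw]
  have e : w = w.take n ++ w.drop n := (List.take_append_drop n w).symm
  rw [e, apply_append, hpow _ hu, (levelSt X n).pow_mem hg _ _ hu,
    hperm (g.sectionAt (w.take n)) (w.drop n) (by simp [hw])]

theorem pow_factorial_pow_mem_levelSt [Finite X] (n : ℕ) (g : TreeAut X) :
    g ^ (Nat.card X).factorial ^ n ∈ levelSt X n := by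
  induction n with
  | zero =>
    intro w hw
    have h := List.length_eq_zero_iff.1 hw
    subst h
    exact List.length_eq_zero_iff.1 (length_apply _ _)
  | succ n ih =>
    rw [pow_succ, pow_mul]
    exact pow_factorial_mem_levelSt ih

theorem eq_one_of_sectionAt_eq_one [Nonempty X] {n : ℕ} {g : TreeAut X} (hg : g ∈ levelSt X n)
    (h : ∀ u : List X, u.length = n → g.sectionAt u = 1) : g = 1 := by
  ext1 w
  let a : X := Classical.arbitrary X
  refine (apply_eq_of_apply_append_eq (w := List.replicate n a) ?_).1
  set v := w ++ List.replicate n a with hv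
  have hu : (v.take n).length = n := by simp [hv]
  have e : v = v.take n ++ v.drop n := (List.take_append_drop n v).symm
  rw [e, apply_append, hg _ hu, h _ hu]
  rfl

/-- By Nakayama's lemma over `ℤ`, a finitely generated commutative group all of whose elements are
`q`-th powers has finite exponent. -/
theorem _root_.CommGroup.finite_of_forall_exists_pow_eq {M : Type*} [CommGroup M]
    [hM : Group.FG M] {q : ℕ} (hq : q ≠ 1) (h : ∀ x : M, ∃ y, y ^ q = x) : Finite M := by
  have hfin : Module.Finite ℤ (Additive M) := Module.Finite.iff_addGroup_fg.2 inferInstance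
  obtain ⟨r, hr, hr0⟩ := Submodule.exists_sub_one_mem_and_smul_eq_zero_of_fg_of_le_smul
    (Ideal.span {(q : ℤ)}) (⊤ : Submodule ℤ (Additive M)) hfin.fg_top (by
      intro x _
      obtain ⟨y, hy⟩ := h x.toMul
      have e : (q : ℤ) • Additive.ofMul y = x := by
        rw [natCast_zsmul]
        exact congrArg Additive.ofMul hy
      rw [← e]
      exact Submodule.smul_mem_smul (Ideal.mem_span_singleton_self _) trivial)
  have hrne : r ≠ 0 := by
    rintro rfl
    have h1 : (q : ℤ) ∣ 1 := by
      have := Ideal.mem_span_singleton.1 hr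
      rwa [zero_sub, dvd_neg] at this
    exact hq (by exact_mod_cast Int.eq_one_of_dvd_one (by positivity) h1)
  have : Finite (Additive M) := Module.finite_of_fg_torsion _ fun x =>
    ⟨⟨r, mem_nonZeroDivisors_of_ne_zero hrne⟩, hr0 x trivial⟩
  exact this

/-- Let `M` be a finitely generated abelian subgroup and `q` a prime larger than the size of the
alphabet. The finite quotients of `M` by level stabilizers have exponent prime to `q`, so
well-approximation forces `M` to consist of `q`-th powers, and `M` is finite. -/
theorem not_commutative_of_wellApproximatedSubgroups [Finite X] {G : Subgroup (TreeAut X)}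
    (hfg : Group.FG G) (hinf : Infinite G) (hwa : WellApproximatedSubgroups G)
    (M : Subgroup G) (hM : M.FiniteIndex) : ¬ ∀ a ∈ M, ∀ b ∈ M, a * b = b * a := by
  intro hcomm
  let _ : CommGroup M :=
    { (inferInstance : Group M) with
      mul_comm := fun a b => Subtype.ext (hcomm a a.2 b b.2) }
  have hMfg : Group.FG M := M.fg_of_index_ne_zero
  obtain ⟨q, hqX, hq⟩ := Nat.exists_infinite_primes (Nat.card X + 1)
  have hpow : ∀ x : M, ∃ y, y ^ q = x := by
    intro x
    let P : Subgroup G := (powMonoidHom q : M →* M).range.map M.subtype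
    have hP : P.FG := by
      refine fg_map _ ?_
      rw [← Group.fg_iff_subgroup_fg]
      infer_instance
    have hx : (x : G) ∈ (P : Set G) := by
      rw [← hwa P hP, Set.mem_iInter]
      intro k
      have hcop : IsCoprime (((Nat.card X).factorial ^ k : ℕ) : ℤ) (q : ℤ) := by
        rw [Nat.isCoprime_iff_coprime]
        refine Nat.Coprime.pow_left k (Nat.Coprime.symm ((hq.coprime_iff_not_dvd).2 fun h => ?_))
        have := (hq.dvd_factorial).1 h
        omega
      obtain ⟨a, b, hab⟩ := hcop
      refine Set.mem_mul.2 ⟨((x ^ b) ^ q : M), ⟨(x ^ b) ^ q, ⟨x ^ b, rfl⟩, rfl⟩,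
        (((x : G) ^ (Nat.card X).factorial ^ k) ^ a : G), zpow_mem (mem_subgroupOf.2 ?_) a, ?_⟩
      · exact pow_factorial_pow_mem_levelSt k (x : TreeAut X)
      · have e : (x : G) ^ (b * (q : ℤ) + (((Nat.card X).factorial ^ k : ℕ) : ℤ) * a) = x := by
          rw [add_comm, mul_comm _ a, hab, zpow_one]
        rw [zpow_add, zpow_mul, zpow_mul, zpow_natCast, zpow_natCast] at e
        exact_mod_cast e
    obtain ⟨_, ⟨y, rfl⟩, hy⟩ := hx
    exact ⟨y, Subtype.ext hy⟩
  have hfin : Finite M := CommGroup.finite_of_forall_exists_pow_eq hq.one_lt.ne' hpow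
  have h1 := M.card_mul_index
  have h2 : Nat.card G ≠ 0 := by
    rw [← h1]
    exact mul_ne_zero Nat.card_pos.ne' hM.index_ne_zero
  exact h2 Nat.card_eq_zero_of_infinite

/-- The homomorphism taking the section at a word of length `n`, from the stabilizer of the `n`-th
level of a strongly self-replicating group to the group itself. -/
def sectionHom {G : Subgroup (TreeAut X)} (hssr : StronglySelfReplicating G) {n : ℕ} (hn : 1 ≤ n)
    (x : {w : List X // w.length = n}) : (levelSt X n).subgroupOf G →* G where
  toFun g := ⟨(g : TreeAut X).sectionAt x, by
    have h := hssr n hn x x.2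
    rw [← SetLike.mem_coe, ← h]
    exact ⟨_, ⟨g.1.2, mem_subgroupOf.1 g.2⟩, rfl⟩⟩
  map_one' := Subtype.ext (sectionAt_one (x : List X))
  map_mul' g h := Subtype.ext (by
    have e : (h : TreeAut X) x = x := mem_subgroupOf.1 h.2 x x.2
    simp [sectionAt_mul, e])

theorem sectionHom_surjective {G : Subgroup (TreeAut X)} (hssr : StronglySelfReplicating G)
    {n : ℕ} (hn : 1 ≤ n) (x : {w : List X // w.length = n}) :
    Function.Surjective (sectionHom hssr hn x) := by
  intro g
  have h := hssr n hn x x.2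
  obtain ⟨k, ⟨hkG, hk⟩, hkg⟩ := h.ge g.2
  exact ⟨⟨⟨k, hkG⟩, mem_subgroupOf.2 hk⟩, Subtype.ext hkg⟩

/-- If the stabilizer of a set `Y` of words in `H` is an infra-direct product, then `H` has finite
index sections at all words of a longer length that extend a member of `Y`. -/
theorem finiteIndex_map_sectionHom [Finite X] {G : Subgroup (TreeAut X)}
    (hssr : StronglySelfReplicating G) {Y : Finset (List X)} {n : ℕ} (hn : 1 ≤ n)
    (hYn : ∀ y ∈ Y, y.length < n) {H : Subgroup G}
    (hH : IsInfraDirectProduct G (stImage (H.map G.subtype) Y))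
    (x : {w : List X // w.length = n}) (hx : ∃ y ∈ Y, y <+: (x : List X)) :
    ((H.subgroupOf ((levelSt X n).subgroupOf G)).map (sectionHom hssr hn x)).FiniteIndex := by
  obtain ⟨x, hxn⟩ := x
  obtain ⟨y, hy, w, rfl⟩ := hx
  have hlen : y.length + w.length = n := by simpa using hxn
  have hw : 1 ≤ w.length := by have := hYn y hy; omega
  let φ := (Pi.evalMonoidHom (fun _ : Y => TreeAut X) ⟨y, hy⟩).comp (psi Y)
  let T := H.map G.subtype
  -- the sections at `y` of the elements of `H` fixing level `n` form a finite index subgroup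
  let R := ((T ⊓ levelSt X n).subgroupOf (st (Y : Set (List X)))).map φ
  have hR : R.relIndex G ≠ 0 := by
    have h1 : ((stImage T Y).map (Pi.evalMonoidHom _ ⟨y, hy⟩)).relIndex G ≠ 0 :=
      (hH.2 ⟨y, hy⟩).index_ne_zero
    rw [stImage, map_map] at h1
    refine relIndex_ne_zero_trans (relIndex_map_ne_zero φ ?_) h1
    have e : (T ⊓ levelSt X n).subgroupOf (st (Y : Set (List X))) =
        T.subgroupOf (st (Y : Set (List X))) ⊓ (levelSt X n).subgroupOf (st (Y : Set (List X))) :=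
      comap_inf _ _ _
    rw [e, inf_relIndex_left]
    exact fun h => index_ne_zero_of_finite (index_eq_zero_of_relIndex_eq_zero h)
  let σ := sectionHom hssr hw ⟨w, rfl⟩
  have hσ : (((R.subgroupOf G).subgroupOf
      ((levelSt X w.length).subgroupOf G)).map σ).FiniteIndex := by
    have : (R.subgroupOf G).FiniteIndex := ⟨hR⟩
    refine finiteIndex_map_of_relIndex_ne_zero σ (M := ⊤) ?_ ?_
    · rw [relIndex_top_right]
      exact index_ne_zero_of_finite
    · rw [← MonoidHom.range_eq_map, MonoidHom.range_eq_top.2 (sectionHom_surjective hssr hw _)]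
      infer_instance
  refine finiteIndex_of_le (H := ((R.subgroupOf G).subgroupOf
    ((levelSt X w.length).subgroupOf G)).map σ) ?_
  rintro _ ⟨r, ⟨s, ⟨⟨h, hhH, hhs⟩, hs⟩, hsr⟩, rfl⟩
  have hh : (h : TreeAut X) ∈ levelSt X n := by
    have : (h : TreeAut X) = s := hhs
    rw [this]
    exact hs
  refine ⟨⟨h, mem_subgroupOf.2 hh⟩, mem_subgroupOf.2 hhH, Subtype.ext ?_⟩
  have e1 : (h : TreeAut X).sectionAt y = (r : TreeAut X) := by
    have e2 : (h : TreeAut X) = s := hhs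
    rw [e2]
    exact hsr
  change (h : TreeAut X).sectionAt (y ++ w) = (r : TreeAut X).sectionAt w
  rw [sectionAt_append, e1]

end TreeAut

theorem mainTheorem6 {X : Type u} [Finite X] (G : Subgroup (TreeAut X))
    (hfg : Group.FG G) (hji : JustInfinite G)
    (hssr : TreeAut.StronglySelfReplicating G)
    (hwa : TreeAut.WellApproximatedSubgroups G)
    (Y : Finset (List X)) (hY : TreeAut.IsSpanningLeafSet Y)
    (H : Subgroup G)
    (hH : IsInfraDirectProduct G (TreeAut.stImage (H.map G.subtype) Y)) :
    cbRank H = ENat.map (fun n : ℕ => (n : Ordinal.{u})) H.depth ∧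
      cbRank H < ((Ordinal.omega0 : Ordinal.{u}) : WithTop Ordinal.{u}) := by
  have hinf : Infinite G := hji.1
  have hG : JustInfiniteNotVirtAbelian G :=
    ⟨fun N hN hne => have := hji.2 N hN hne; Subgroup.finiteIndex_of_finite_quotient,
      TreeAut.not_commutative_of_wellApproximatedSubgroups hfg hinf hwa⟩
  have hX : Nonempty X := by
    by_contra h
    rw [not_nonempty_iff] at h
    have : Subsingleton (TreeAut X) := ⟨fun g h => by
      ext1 w
      rw [Subsingleton.elim (g w) (h w)]⟩
    exact not_finite G
  obtain ⟨-, N, hN⟩ := hY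
  obtain ⟨n, hn1, hnN, hnY⟩ : ∃ n, 1 ≤ n ∧ N ≤ n ∧ ∀ y ∈ Y, y.length < n :=
    ⟨max N (Y.sup List.length + 1), by omega, le_max_left _ _, fun y hy =>
      lt_of_lt_of_le (Nat.lt_succ_of_le (Finset.le_sup (f := List.length) hy)) (le_max_right _ _)⟩
  let e := (Finite.equivFin {w : List X // w.length = n}).symm
  let f := fun i => TreeAut.sectionHom hssr hn1 (e i)
  have hf : ∀ g, (∀ i, f i g = 1) → g = 1 := by
    intro g hg
    refine Subtype.ext (Subtype.ext (TreeAut.eq_one_of_sectionAt_eq_one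
      (Subgroup.mem_subgroupOf.1 g.2) fun u hu => ?_))
    have h1 := hg (e.symm ⟨u, hu⟩)
    have h2 : TreeAut.sectionHom hssr hn1 ⟨u, hu⟩ g = 1 := by simpa [f] using h1
    exact congrArg Subtype.val h2
  have hHf : HasFiniteIndexImages f H := fun i =>
    TreeAut.finiteIndex_map_sectionHom hssr hn1 hnY hH (e i)
      (hN (e i) (by rw [(e i).2]; exact hnN))
  exact cbRank_eq_depth (D := {L | HasFiniteIndexImages f L}) (fun L hL M h => hL.mono h)
    (fun L hL => hL.fg hG hfg hf) (fun L hL => hL.depth_ne_top hG hf)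
    (fun L hL => hL.finite_overgroups hG hf) (S := fun k => (TreeAut.levelSt X k).subgroupOf G)
    (fun k l h => Subgroup.comap_mono (TreeAut.levelSt_antitone h))
    (fun L hL => hwa L (hL.fg hG hfg hf)) hHf
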